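/- Let $\mathbb X\subset\mathbb R^n$ be compact with Lebesgue measure $|\mathbb X|$, let $p^\tau_x\colon\mathbb X\to[0,\infty)$ ($x\in\mathbb X$) be the transition densities, at a fixed lag time $\tau>0$, of a Markov process on $\mathbb X$, and let $\rho>0$ be an invariant probability density, $\rho(y)=\int_{\mathbb X}\rho(x)p^\tau_x(y)\,dx$. Write $\|f\|_{L^2_{1/\rho}}=(\int_{\mathbb X}f^2/\rho\,dx)^{1/2}$. Let $k\colon\mathbb X\times\mathbb X\to\mathbb R$ be a continuous positive definite kernel with reproducing kernel Hilbert space $\mathbb H$ that satisfies the Mercer condition $\iint k(x,y)f(x)f(y)\,dx\,dy>0$ for all $0\ne f\in L^2(\mathbb X)$; let $\mu(f)=\int_{\mathbb X}k(x,\cdot)f(x)\,dx\in\mathbb H$ be the kernel mean embedding, and let $(\lambda_i,\varphi_i)_{i\ge0}$ be the eigenpairs of the integral operator $f\mapsto\int_{\mathbb X}k(\cdot,y)f(y)\,dy$ on $L^2(\mathbb X)$, with orthonormal $\varphi_i$ and the $\lambda_i$ in nonincreasing order, counted with multiplicity. For $h\in L^2(\mathbb X)$ put $\tilde h_i=\langle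 h,\varphi_i\rangle_{L^2}$ and $$c(h,i_{\max})=1+\frac{\sum_{i>i_{\max}}\tilde h_i^2}{\sum_{i\le i_{\max}}\tilde h_i^2},$$ which is $+\infty$ if $h\neq0$ and $\tilde h_i=0$ for all $i\le i_{\max}$. Let $\mathbb M\subset\{p^\tau_x : x\in\mathbb X\}$ (for example a transition manifold) consist of functions in $L^2(\mathbb X)$. Assume the following. (i) Regularity bound: for the index $i_{\max}$ there is a constant $c^*_{i_{\max}}>0$ with $c(p^\tau_{x_1}-p^\tau_{x_2},i_{\max})\le c^*_{i_{\max}}$ for all distinct $p^\tau_{x_1},p^\tau_{x_2}\in\mathbb M$. (ii) Metastable decomposition: for all $x,y\in\mathbb X$, $$p^\tau_x(y)=\frac1{1-\delta(x,y)}\sum_{i=1}^d c_i(x)\,p^\tau_{A_i}(y),$$ where $0<\delta(x,y)\le\delta^*<1$, $c_i\ge0$, $\sum_{i=1}^d c_i(x)\le1$, $p^\tau_{A_i}\ge0$ (here $c_i(x)$ is the probability of being attracted from $x$ to the metastable set $A_i$, and $p^\tau_{A_i}$ is the density of moving from $A_i$ in time $\tau$), and $b_i:=\int_{\mathbb X}\rho(x)c_i(x)\,dx>0$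 for every $i$. Then for every $C>0$ and all $p^\tau_{x_1},p^\tau_{x_2}\in\mathbb M$ with $\|p^\tau_{x_1}-p^\tau_{x_2}\|_{L^2_{1/\rho}}\ge C$, $$\|p^\tau_{x_1}-p^\tau_{x_2}\|_{L^2_{1/\rho}}<\frac{|\mathbb X|^{1/2}}{C\,(1-\delta^*)\min_i b_i}\,\sqrt{\frac{c^*_{i_{\max}}}{\lambda_{i_{\max}}}}\;\big\|\mu(p^\tau_{x_1})-\mu(p^\tau_{x_2})\big\|_{\mathbb H}.$$ -/

import Mathlib

open MeasureTheory
open scoped ENNReal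

attribute [local instance] MeasureTheory.Measure.Subtype.measureSpace

noncomputable section

namespace KernelTM

section Dynamics

variable {Ω : Type*} [MeasureSpace Ω]

/-- `p x` is the density, with respect to Lebesgue measure, of the position of a Markov process
after a fixed lag time when it is started at `x`. -/
structure IsTransitionDensity (p : Ω → Ω → ℝ) : Prop where
  measurable : Measurable (Function.uncurry p)
  nonneg : ∀ x y, 0 ≤ p x y
  integral_eq_one : ∀ x, ∫ y, p x y = 1

/-- `ρ` is a positive probability density that is invariant under the transition density `p`. -/
structure IsInvariantDensity (p : Ω → Ω → ℝ) (ρ : Ω → ℝ) : Prop where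
  measurable : Measurable ρ
  pos : ∀ᵐ x, 0 < ρ x
  integral_eq_one : ∫ x, ρ x = 1
  invariant : ∀ᵐ y, ρ y = ∫ x, ρ x * p x y

/-- The fuzzy transition manifold: the set of all transition densities. -/
def fuzzyTransitionManifold (p : Ω → Ω → ℝ) : Set (Ω → ℝ) := Set.range p

/-- The norm of `L²` with weight `1/ρ`, that is `(∫ f² / ρ)^(1/2)`; the value `∞` says that `f` does
not belong to this space. -/
def weightedL2Norm (ρ f : Ω → ℝ) : ℝ≥0∞ :=
  eLpNorm f 2 (volume.withDensity fun x => ENNReal.ofReal (1 / ρ x))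

/-- The metastable decomposition `p x y = (1 - δ(x,y))⁻¹ ∑ i, c i x * pA i y` with `d` metastable
sets: `c i x` is the probability to be attracted from `x` to the `i`-th set, `pA i y` is the
density of moving from that set to `y`, and `0 < δ ≤ δs < 1`. -/
structure IsMetastableDecomposition (p : Ω → Ω → ℝ) {d : ℕ} (c pA : Fin d → Ω → ℝ)
    (δ : Ω → Ω → ℝ) (δs : ℝ) : Prop where
  measurable_c : ∀ i, Measurable (c i)
  c_nonneg : ∀ i x, 0 ≤ c i x
  sum_c_le_one : ∀ x, ∑ i, c i x ≤ 1
  pA_nonneg : ∀ i y, 0 ≤ pA i y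
  delta_pos : ∀ x y, 0 < δ x y
  delta_le : ∀ x y, δ x y ≤ δs
  deltaStar_lt_one : δs < 1
  decomposition : ∀ x y, p x y = 1 / (1 - δ x y) * ∑ i, c i x * pA i y

/-- `b = ∫ ρ c`: the equilibrium probability mass attracted to a metastable set. -/
def attractedMass (ρ c : Ω → ℝ) : ℝ := ∫ x, ρ x * c x

end Dynamics

section Kernel

variable {Ω : Type*} [MeasureSpace Ω]

/-- The integral operator `(T_k f)(x) = ∫ k(x,y) f(y) dy`. -/
def integralOp (k : Ω → Ω → ℝ) (f : Ω → ℝ) (x : Ω) : ℝ := ∫ y, k x y * f y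

/-- `f ∈ L²` satisfies `T_k f = l f`. -/
def IsEigenfunction (k : Ω → Ω → ℝ) (l : ℝ) (f : Ω → ℝ) : Prop :=
  MemLp f 2 ∧ ∀ᵐ x, integralOp k f x = l * f x

/-- The Mercer condition. -/
def MercerCondition (k : Ω → Ω → ℝ) : Prop :=
  ∀ f : Ω → ℝ, MemLp f 2 → ¬ f =ᵐ[volume] 0 → 0 < ∫ x, ∫ y, k x y * f x * f y

/-- `(l i, φ i)` is an enumeration of the eigenpairs of the integral operator, in nonincreasing
order of the eigenvalues and counted with multiplicity: the `φ i` are orthonormal eigenfunctions,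
and no further eigenfunction is orthogonal to all of them. -/
structure IsMercerSystem (k : Ω → Ω → ℝ) (l : ℕ → ℝ) (φ : ℕ → Ω → ℝ) : Prop where
  antitone : Antitone l
  eigen : ∀ i, IsEigenfunction k (l i) (φ i)
  orthonormal : ∀ i j, ∫ x, φ i x * φ j x = if i = j then 1 else 0
  exhaustive : ∀ (m : ℝ) (f : Ω → ℝ), IsEigenfunction k m f →
    (∀ i, ∫ x, f x * φ i x = 0) → f =ᵐ[volume] 0

/-- The `i`-th coefficient of `h` with respect to the eigenfunctions `φ`. -/
def mercerCoeff (φ : ℕ → Ω → ℝ) (h : Ω → ℝ) (i : ℕ) : ℝ := ∫ x, h x * φ i x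

/-- The factor `1 + (∑_{i > N} h_i²) / (∑_{i ≤ N} h_i²)`. If all coefficients up to `N` vanish, but
not all later ones, its value is `∞`. -/
def modeFactor (φ : ℕ → Ω → ℝ) (h : Ω → ℝ) (N : ℕ) : ℝ≥0∞ :=
  1 + (∑' i, ENNReal.ofReal (mercerCoeff φ h (N + 1 + i) ^ 2)) /
    ∑ i ∈ Finset.range (N + 1), ENNReal.ofReal (mercerCoeff φ h i ^ 2)

/-- The regularity bound on the set `M` with constant `cs` for the index `N`: it concerns the
differences of any two distinct (not almost everywhere equal) elements of `M`. -/
def RegularityBound (φ : ℕ → Ω → ℝ) (M : Set (Ω → ℝ)) (N : ℕ) (cs : ℝ) : Prop :=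
  ∀ f ∈ M, ∀ g ∈ M, ¬ f =ᵐ[volume] g → modeFactor φ (f - g) N ≤ ENNReal.ofReal cs

variable (H : Type*) [NormedAddCommGroup H] [InnerProductSpace ℝ H] [CompleteSpace H]
  [RKHS ℝ H Ω ℝ]

/-- The reproducing kernel of the Hilbert space `H` of functions is `k`: the element of `H` that
represents the evaluation at `x` is the function `k(x, ·)`. -/
def HasReproducingKernel (k : Ω → Ω → ℝ) : Prop :=
  ∀ x y, (RKHS.kerFun H x (1 : ℝ)) y = k x y

/-- The kernel mean embedding `μ(f) = ∫ k(x, ·) f(x) dx`, a Bochner integral in `H`. -/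
def kernelMean (f : Ω → ℝ) : H := ∫ x, f x • RKHS.kerFun H x (1 : ℝ)

end Kernel

end KernelTM

end

namespace KernelTM

/-! ### Domination of the transition densities by the invariant density, and weighted norms. -/

section Dynamics

variable {Ω : Type*} [MeasureSpace Ω]

/-! Put `h = p x₁ - p x₂` and `κ = (1 - δs) * min b`. Integrating the decomposition against `ρ`
gives `ρ > ∑ b_i pA_i ≥ κ p_x` almost everywhere, strictly because `δ > 0`
(`ae_iInf_attractedMass_mul_lt`). Hence `κ|h| < ρ`, so `∫ h²/ρ < κ⁻¹ ∫ |h|`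
(`weightedL2Norm_sq_lt`), and Cauchy–Schwarz on the finite measure space bounds the right side by
`κ⁻¹ |X|^(1/2) ‖h‖₂`.

The rest compares `‖h‖₂` with the embedding (`norm_toLp_le_norm_kernelMean`). Let `S : H → L²` be
the inclusion; then `μ = S*` and `S S*` is the integral operator. It is compact and symmetric, so
the exhaustive eigenfunctions form a Hilbert basis, and Parseval with the regularity bound gives
`‖h‖₂² ≤ cs ∑_{i ≤ N} h_i²`. Since the eigenvalues decrease, `l N ∑_{i ≤ N} h_i² ≤ ‖S* h‖²`
(`mul_sum_inner_sq_le_norm_adjoint_sq`). The assumption that the weighted norm is at least `C`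
finally turns the bound on its square into a bound on the norm itself. -/

/-- The invariant density strictly dominates every transition density, up to the factor
`(1 - δs) * min b`. -/
theorem ae_iInf_attractedMass_mul_lt {p : Ω → Ω → ℝ} {ρ : Ω → ℝ}
    (hp : IsTransitionDensity p) (hρ : IsInvariantDensity p ρ)
    {d : ℕ} {c pA : Fin d → Ω → ℝ} {δ : Ω → Ω → ℝ} {δs : ℝ}
    (hdec : IsMetastableDecomposition p c pA δ δs) (hb : ∀ i, 0 < attractedMass ρ (c i)) :
    ∀ᵐ y, ∀ x, (1 - δs) * (⨅ i, attractedMass ρ (c i)) * p x y < ρ y := by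
  set β := ⨅ i, attractedMass ρ (c i)
  have hβ0 : 0 ≤ β := Real.iInf_nonneg fun i => (hb i).le
  have hβ : ∀ i, β ≤ attractedMass ρ (c i) := fun i =>
    ciInf_le (Set.finite_range _).bddBelow i
  have hc1 : ∀ i x, c i x ≤ 1 := fun i x =>
    (Finset.single_le_sum (f := fun i => c i x) (fun j _ => hdec.c_nonneg j x)
      (Finset.mem_univ i)).trans (hdec.sum_c_le_one x)
  have hsum : ∀ x y, ∑ i, c i x * pA i y = (1 - δ x y) * p x y := by
    intro x y
    have h1 : (1 - δ x y) ≠ 0 := by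
      linarith [hdec.delta_le x y, hdec.deltaStar_lt_one]
    rw [hdec.decomposition x y]
    field_simp
  filter_upwards [hρ.pos, hρ.invariant] with y hy hinv x
  -- A non-integrable function has Bochner integral `0`, so positivity of `ρ y`, and below of `b_i`,
  -- forces integrability.
  have hint : Integrable fun x => ρ x * p x y := by
    by_contra h
    rw [integral_undef h] at hinv
    exact hy.ne' hinv
  have hintc : ∀ i, Integrable fun x => ρ x * c i x := by
    intro i
    by_contra h
    exact (hb i).ne' (integral_undef h)
  have hintS : Integrable fun x => ρ x * ∑ i, c i x * pA i y := by
    simp_rw [Finset.mul_sum, ← mul_assoc]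
    exact integrable_finsetSum _ fun i _ => (hintc i).mul_const _
  have hS : ∫ x, ρ x * ∑ i, c i x * pA i y = ∑ i, attractedMass ρ (c i) * pA i y := by
    simp_rw [Finset.mul_sum, ← mul_assoc]
    rw [integral_finsetSum _ fun i _ => (hintc i).mul_const _]
    simp_rw [integral_mul_const, attractedMass]
  have hnn : 0 ≤ᵐ[volume] fun x => ρ x * p x y - ρ x * ∑ i, c i x * pA i y := by
    filter_upwards [hρ.pos] with x hx
    have : ρ x * p x y - ρ x * ∑ i, c i x * pA i y = ρ x * (δ x y * p x y) := by
      rw [hsum]; ring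
    rw [this]
    exact mul_nonneg hx.le (mul_nonneg (hdec.delta_pos x y).le (hp.nonneg x y))
  have hlt : ∑ i, attractedMass ρ (c i) * pA i y < ρ y := by
    rw [← hS, hinv]
    refine lt_of_le_of_ne ?_ ?_
    · have := integral_nonneg_of_ae hnn
      rw [integral_sub hint hintS] at this
      linarith
    -- Equality would make `ρ δ p(·, y)` vanish almost everywhere; as `ρ` and `δ` are positive,
    -- invariance would then give `ρ y = 0`.
    · intro heq
      have h0 := (integral_eq_zero_iff_of_nonneg_ae hnn (hint.sub hintS)).1
        (by rw [integral_sub hint hintS, heq, sub_self])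
      have hz : (fun x => ρ x * p x y) =ᵐ[volume] 0 := by
        filter_upwards [h0, hρ.pos] with x hx hx0
        have h2 : ρ x * (δ x y * p x y) = 0 := by
          rw [← show ρ x * p x y - ρ x * ∑ i, c i x * pA i y = ρ x * (δ x y * p x y) by
            rw [hsum]; ring]
          exact hx
        simpa [hx0.ne', (hdec.delta_pos x y).ne'] using h2
      rw [integral_eq_zero_of_ae hz] at hinv
      exact hy.ne' hinv
  calc (1 - δs) * β * p x y ≤ β * ∑ i, pA i y := by
        have h1 : (1 - δs) * p x y ≤ ∑ i, pA i y :=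
          calc (1 - δs) * p x y ≤ (1 - δ x y) * p x y :=
                mul_le_mul_of_nonneg_right (by linarith [hdec.delta_le x y]) (hp.nonneg x y)
            _ = ∑ i, c i x * pA i y := (hsum x y).symm
            _ ≤ ∑ i, pA i y := Finset.sum_le_sum fun i _ =>
                mul_le_of_le_one_left (hdec.pA_nonneg i y) (hc1 i x)
        calc (1 - δs) * β * p x y = β * ((1 - δs) * p x y) := by ring
          _ ≤ _ := mul_le_mul_of_nonneg_left h1 hβ0
    _ ≤ ∑ i, attractedMass ρ (c i) * pA i y := by
        rw [Finset.mul_sum]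
        exact Finset.sum_le_sum fun i _ => mul_le_mul_of_nonneg_right (hβ i) (hdec.pA_nonneg i y)
    _ < ρ y := hlt

/-- The minimal attracted mass is positive, because some metastable set has to exist. -/
theorem iInf_attractedMass_pos {p : Ω → Ω → ℝ} {ρ : Ω → ℝ} (hp : IsTransitionDensity p) (x : Ω)
    {d : ℕ} {c pA : Fin d → Ω → ℝ} {δ : Ω → Ω → ℝ} {δs : ℝ}
    (hdec : IsMetastableDecomposition p c pA δ δs) (hb : ∀ i, 0 < attractedMass ρ (c i)) :
    0 < ⨅ i, attractedMass ρ (c i) := by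
  -- For `d = 0` the real infimum is `0` by convention; this case is impossible because `p x` would
  -- vanish identically.
  rcases isEmpty_or_nonempty (Fin d) with h | h
  · have h0 : ∀ y, p x y = 0 := fun y => by simp [hdec.decomposition x y]
    have := hp.integral_eq_one x
    simp [h0] at this
  · obtain ⟨i, hi⟩ := exists_eq_ciInf_of_finite (f := fun i => attractedMass ρ (c i))
    rw [← hi]
    exact hb i

/-- If `|h| < ρ / κ`, then `‖h‖²` in `L²` with weight `1/ρ` is less than `‖h‖₁ / κ`. -/
theorem weightedL2Norm_sq_lt {ρ h : Ω → ℝ} {κ : ℝ} (hκ : 0 < κ) (hρ : Measurable ρ)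
    (hh : Measurable h) (hint : Integrable h) (hlt : ∀ᵐ y, κ * |h y| < ρ y)
    (h0 : ¬ h =ᵐ[volume] 0) :
    weightedL2Norm ρ h ^ 2 < ENNReal.ofReal (κ⁻¹ * ∫ y, |h y|) := by
  have hw : weightedL2Norm ρ h ^ 2 = ∫⁻ y, ENNReal.ofReal (1 / ρ y * h y ^ 2) := by
    have h2 := eLpNorm_nnreal_pow_eq_lintegral (f := h) (p := 2)
      (μ := volume.withDensity fun x => ENNReal.ofReal (1 / ρ x)) (by norm_num)
    have e2 : ((2 : NNReal) : ℝ≥0∞) = 2 := rfl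
    have e3 : ((2 : NNReal) : ℝ) = (2 : ℕ) := rfl
    rw [e2, e3] at h2
    simp only [ENNReal.rpow_natCast] at h2
    rw [weightedL2Norm, h2, lintegral_withDensity_eq_lintegral_mul _ (by fun_prop) (by fun_prop)]
    refine lintegral_congr_ae ?_
    filter_upwards [hlt] with y hy
    have hy0 : 0 < ρ y := lt_of_le_of_lt (by positivity) hy
    simp only [Pi.mul_apply]
    rw [ENNReal.ofReal_mul (by positivity), ← sq_abs (h y), ENNReal.ofReal_pow (abs_nonneg _),
      Real.enorm_eq_ofReal_abs]
  have hr : ENNReal.ofReal (κ⁻¹ * ∫ y, |h y|) = ∫⁻ y, ENNReal.ofReal (κ⁻¹ * |h y|) := by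
    rw [← integral_const_mul,
      ofReal_integral_eq_lintegral_ofReal (hint.abs.const_mul _) (ae_of_all _ fun y => by positivity)]
  -- The difference of the two integrands factors as `|h| (ρ - κ|h|) / (κρ)`, whose second factor is
  -- positive: the inequality is strict exactly where `h ≠ 0`.
  have key : ∀ᵐ y, 1 / ρ y * h y ^ 2 ≤ κ⁻¹ * |h y| ∧
      (1 / ρ y * h y ^ 2 = κ⁻¹ * |h y| → h y = 0) := by
    filter_upwards [hlt] with y hy
    have hy0 : 0 < ρ y := lt_of_le_of_lt (by positivity) hy
    have e : κ⁻¹ * |h y| - 1 / ρ y * h y ^ 2 = |h y| * ((ρ y - κ * |h y|) / (κ * ρ y)) := by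
      rw [← sq_abs (h y)]; field_simp
    have hpos : 0 < (ρ y - κ * |h y|) / (κ * ρ y) := div_pos (by linarith) (by positivity)
    constructor
    · have := mul_nonneg (abs_nonneg (h y)) hpos.le
      linarith
    · intro h1
      have h2 : |h y| * ((ρ y - κ * |h y|) / (κ * ρ y)) = 0 := by rw [← e, h1, sub_self]
      simpa [hpos.ne'] using h2
  have hle : (fun y => ENNReal.ofReal (1 / ρ y * h y ^ 2)) ≤ᵐ[volume]
      fun y => ENNReal.ofReal (κ⁻¹ * |h y|) := by
    filter_upwards [key] with y hy using ENNReal.ofReal_le_ofReal hy.1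
  rw [hw, hr]
  refine lintegral_strict_mono_of_ae_le_of_frequently_ae_lt (by fun_prop) ?_ hle ?_
  · refine ne_top_of_le_ne_top ?_ (lintegral_mono_ae hle)
    rw [← hr]
    exact ENNReal.ofReal_ne_top
  · intro hcon
    apply h0
    filter_upwards [hcon, key, hlt] with y hy hk hl
    have hy0 : 0 < ρ y := lt_of_le_of_lt (by positivity) hl
    refine hk.2 ?_
    have := not_not.1 hy
    rwa [ENNReal.ofReal_eq_ofReal_iff (by positivity) (by positivity)] at this

/-- The Cauchy–Schwarz inequality with the constant function. -/
theorem integral_abs_le_sqrt_mul_norm [IsFiniteMeasure (volume : Measure Ω)] {h : Ω → ℝ}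
    (hh : MemLp h 2) :
    ∫ y, |h y| ≤ √((volume (Set.univ : Set Ω)).toReal) * ‖hh.toLp h‖ := by
  have h1 := eLpNorm_le_eLpNorm_mul_rpow_measure_univ (μ := (volume : Measure Ω)) (f := h)
    (p := 1) (q := 2) (by norm_num) hh.1
  have h2 := ENNReal.toReal_mono
    (ENNReal.mul_ne_top hh.eLpNorm_ne_top (ENNReal.rpow_ne_top_of_nonneg (by norm_num)
      (measure_ne_top _ _))) h1
  rw [ENNReal.toReal_mul, ← ENNReal.toReal_rpow] at h2
  rw [Lp.norm_toLp, mul_comm, Real.sqrt_eq_rpow]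
  have h3 : (eLpNorm h 1 volume).toReal = ∫ y, |h y| := by
    rw [eLpNorm_one_eq_lintegral_enorm, ← integral_norm_eq_lintegral_enorm hh.1]
    rfl
  rw [h3] at h2
  norm_num at h2 ⊢
  exact h2

end Dynamics

/-! ### Compact symmetric operators and the energy in the leading eigenvectors. -/

section Spectral

open Module.End

/-- Eigenvectors of a compact symmetric operator have a dense span if there is no further
eigenvector orthogonal to all of them. -/
theorem orthogonal_span_eigenvectors_eq_bot {E ι : Type*} [NormedAddCommGroup E]
    [InnerProductSpace ℝ E] [CompleteSpace E] {T : E →L[ℝ] E} (hT : IsCompactOperator T)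
    (hT' : (T : E →ₗ[ℝ] E).IsSymmetric) {v : ι → E} {l : ι → ℝ} (hv : ∀ i, T (v i) = l i • v i)
    (hex : ∀ (m : ℝ) (x : E), T x = m • x → (∀ i, inner ℝ (v i) x = 0) → x = 0) :
    (Submodule.span ℝ (Set.range v))ᗮ = ⊥ := by
  set V := (Submodule.span ℝ (Set.range v))ᗮ with hV
  have hmem : ∀ x, x ∈ V ↔ ∀ i, inner ℝ (v i) x = 0 := by
    intro x
    rw [hV, Submodule.mem_orthogonal]
    refine ⟨fun h i => h _ (Submodule.subset_span ⟨i, rfl⟩), fun h u hu => ?_⟩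
    induction hu using Submodule.span_induction with
    | mem u hu => obtain ⟨i, rfl⟩ := hu; exact h i
    | zero => exact inner_zero_left _
    | add a b _ _ ha hb => rw [inner_add_left, ha, hb, add_zero]
    | smul r a _ ha => rw [real_inner_smul_left, ha, mul_zero]
  have hinv : ∀ x ∈ V, T x ∈ V := by
    intro x hx
    rw [hmem] at hx ⊢
    intro i
    have h1 : inner ℝ (T (v i)) x = inner ℝ (v i) (T x) := hT' (v i) x
    rw [← h1, hv, real_inner_smul_left, hx, mul_zero]
  -- By symmetry `T` preserves the orthogonal complement. Its restriction is compact and symmetric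
  -- with no eigenvector, even for eigenvalue `0`, so the spectral theorem leaves only the zero
  -- space.
  let S : V →L[ℝ] V := T.restrict hinv
  have hS : IsCompactOperator S := hT.restrict' (f := (T : E →ₗ[ℝ] E)) hinv
  have hS' : (S : V →ₗ[ℝ] V).IsSymmetric := hT'.restrict_invariant hinv
  have heig : ∀ m, eigenspace (S : Module.End ℝ V) m = ⊥ := by
    intro m
    rw [Submodule.eq_bot_iff]
    intro x hx
    rw [mem_eigenspace_iff] at hx
    have hx' : T x = m • (x : E) := congrArg Subtype.val hx
    exact Subtype.ext (hex m x hx' ((hmem x).1 x.2))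
  have h := ContinuousLinearMap.orthogonalComplement_iSup_eigenspaces_eq_bot hS hS'
  simp only [heig, iSup_bot, Submodule.bot_orthogonal_eq_top] at h
  rw [Submodule.eq_bot_iff]
  intro x hx
  have : (⟨x, hx⟩ : V) ∈ (⊤ : Submodule ℝ V) := trivial
  rw [h, Submodule.mem_bot] at this
  exact congrArg Subtype.val this

/-- If `S` maps `H` to `E`, and `v` is an orthonormal family of eigenvectors of `S S*`, then the
energy of `x` in the first eigenvectors is controlled by `‖S* x‖`. -/
theorem mul_sum_inner_sq_le_norm_adjoint_sq {E H : Type*} [NormedAddCommGroup E]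
    [InnerProductSpace ℝ E] [CompleteSpace E] [NormedAddCommGroup H] [InnerProductSpace ℝ H]
    [CompleteSpace H] (S : H →L[ℝ] E) {v : ℕ → E} (hv : Orthonormal ℝ v) {l : ℕ → ℝ}
    (hl : Antitone l) (hS : ∀ i, S (S.adjoint (v i)) = l i • v i) (N : ℕ) (x : E) :
    l N * ∑ i ∈ Finset.range (N + 1), inner ℝ (v i) x ^ 2 ≤ ‖S.adjoint x‖ ^ 2 := by
  set a : ℕ → ℝ := fun i => inner ℝ (v i) x
  set u : E := ∑ i ∈ Finset.range (N + 1), a i • v i with hu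
  have hadj : ∀ i z, inner ℝ (S.adjoint (v i)) (S.adjoint z) = l i * inner ℝ (v i) z := by
    intro i z
    rw [ContinuousLinearMap.adjoint_inner_right, hS, real_inner_smul_left]
  have hvu : ∀ i ∈ Finset.range (N + 1), inner ℝ (v i) u = a i := fun i hi =>
    hv.inner_right_sum a hi
  have hAu : ∀ z, inner ℝ (S.adjoint u) (S.adjoint z) =
      ∑ i ∈ Finset.range (N + 1), a i * (l i * inner ℝ (v i) z) := by
    intro z
    rw [hu, map_sum, sum_inner]
    refine Finset.sum_congr rfl fun i _ => ?_
    rw [map_smul, real_inner_smul_left, hadj]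
  -- The projection `u` and the remainder `x - u` keep orthogonal images under `S*`, since the `v i`
  -- are eigenvectors of `S S*`; the remainder's energy can thus be dropped.
  have horth : inner ℝ (S.adjoint u) (S.adjoint (x - u)) = 0 := by
    rw [hAu]
    refine Finset.sum_eq_zero fun i hi => ?_
    rw [inner_sub_right, hvu i hi]
    simp [a]
  have hsplit : ‖S.adjoint x‖ ^ 2 = ‖S.adjoint u‖ ^ 2 + ‖S.adjoint (x - u)‖ ^ 2 := by
    have h1 : S.adjoint x = S.adjoint u + S.adjoint (x - u) := by rw [← map_add]; congr 1; abel
    rw [h1, norm_add_sq_real, horth]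
    ring
  have hnorm : ‖S.adjoint u‖ ^ 2 = ∑ i ∈ Finset.range (N + 1), l i * a i ^ 2 := by
    rw [← real_inner_self_eq_norm_sq, hAu]
    refine Finset.sum_congr rfl fun i hi => ?_
    rw [hvu i hi]; ring
  rw [hsplit, hnorm, Finset.mul_sum]
  refine (Finset.sum_le_sum fun i hi => ?_).trans (le_add_of_nonneg_right (sq_nonneg _))
  exact mul_le_mul_of_nonneg_right (hl (Nat.lt_succ_iff.1 (Finset.mem_range.1 hi))) (sq_nonneg _)

end Spectral

/-! ### The inclusion of the kernel space into `L²` and its adjoint. -/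

section FeatureMap

open scoped BoundedContinuousFunction

variable {Ω : Type*} [TopologicalSpace Ω] [CompactSpace Ω]
  {H : Type*} [NormedAddCommGroup H] [InnerProductSpace ℝ H]

/-- The linear map that takes `g` to the continuous function `x ↦ ⟪K x, g⟫`. -/
noncomputable def featureEval (K : C(Ω, H)) : H →ₗ[ℝ] (Ω →ᵇ ℝ) where
  toFun g := BoundedContinuousFunction.mkOfCompact ⟨fun x => inner ℝ (K x) g, by fun_prop⟩
  map_add' g g' := by ext x; simp [inner_add_right]
  map_smul' r g := by ext x; simp [inner_smul_right]

@[simp]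
theorem featureEval_apply (K : C(Ω, H)) (g : H) (x : Ω) :
    featureEval K g x = inner ℝ (K x) g := rfl

/-- Arzelà–Ascoli: for `g` in the unit ball, the functions `x ↦ ⟪K x, g⟫` are bounded by `‖K‖` and
inherit the modulus of continuity of `K`. -/
theorem isCompactOperator_featureEval (K : C(Ω, H)) : IsCompactOperator (featureEval K) := by
  rw [isCompactOperator_iff_isCompact_closure_image_closedBall _ one_pos]
  refine BoundedContinuousFunction.arzela_ascoli (Metric.closedBall 0 ‖K‖)
    (isCompact_closedBall _ _) _ ?_ ?_
  · rintro _ x ⟨g, hg, rfl⟩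
    rw [mem_closedBall_zero_iff] at hg ⊢
    calc ‖inner ℝ (K x) g‖ ≤ ‖K x‖ * ‖g‖ := norm_inner_le_norm _ _
      _ ≤ ‖K‖ * 1 := mul_le_mul (K.norm_coe_le_norm x) hg (norm_nonneg _) (norm_nonneg _)
      _ = ‖K‖ := mul_one _
  · intro x
    rw [Metric.equicontinuousAt_iff_right]
    intro ε hε
    filter_upwards [Metric.tendsto_nhds.1 K.continuous.continuousAt.tendsto ε hε] with y hy
    rintro ⟨_, g, hg, rfl⟩
    rw [mem_closedBall_zero_iff] at hg
    simp only [featureEval_apply]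
    rw [dist_eq_norm, ← inner_sub_left]
    calc ‖inner ℝ (K x - K y) g‖ ≤ ‖K x - K y‖ * ‖g‖ := norm_inner_le_norm _ _
      _ ≤ ‖K x - K y‖ * 1 := mul_le_mul_of_nonneg_left hg (norm_nonneg _)
      _ < ε := by rwa [mul_one, ← dist_eq_norm, dist_comm]

variable [MeasureSpace Ω] [BorelSpace Ω] [IsFiniteMeasure (volume : Measure Ω)]

/-- The embedding of `H` into `L²` by the functions `x ↦ ⟪K x, g⟫`. -/
noncomputable def featureL2 (K : C(Ω, H)) : H →L[ℝ] Lp ℝ 2 (volume : Measure Ω) :=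
  (BoundedContinuousFunction.toLp 2 volume ℝ).comp
    (ContinuousLinearMap.mkOfIsCompactOperator (isCompactOperator_featureEval K))

theorem coeFn_featureL2 (K : C(Ω, H)) (g : H) :
    featureL2 K g =ᵐ[volume] fun x => inner ℝ (K x) g :=
  BoundedContinuousFunction.coeFn_toLp _ _ _ _

theorem isCompactOperator_featureL2 (K : C(Ω, H)) : IsCompactOperator (featureL2 K) :=
  (isCompactOperator_featureEval K).clm_comp (BoundedContinuousFunction.toLp 2 volume ℝ)

variable [CompleteSpace H]

/-- With `S = featureL2 K`, the value of `S S* f` at `x` is `⟪K x, S* f⟫ = ⟪S (K x), f⟫`, which is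
the kernel integral. -/
theorem coeFn_featureL2_adjoint (K : C(Ω, H)) {f : Ω → ℝ} (hf : MemLp f 2) :
    featureL2 K ((featureL2 K).adjoint (hf.toLp f)) =ᵐ[volume]
      integralOp (fun x y => inner ℝ (K x) (K y)) f := by
  filter_upwards [coeFn_featureL2 K ((featureL2 K).adjoint (hf.toLp f))] with x hx
  rw [hx, ContinuousLinearMap.adjoint_inner_right, L2.inner_def, integralOp]
  refine integral_congr_ae ?_
  filter_upwards [coeFn_featureL2 K (K x), hf.coeFn_toLp] with y h1 h2
  rw [h1, h2, real_inner_comm (K y) (K x)]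
  simp [mul_comm]

/-- Both sides have the same pairing with every `g`. This identifies the mean embedding as an
adjoint and makes its norm accessible to spectral arguments. -/
theorem integral_smul_eq_featureL2_adjoint [SecondCountableTopology Ω] (K : C(Ω, H)) {f : Ω → ℝ}
    (hf : MemLp f 2) : ∫ x, f x • K x = (featureL2 K).adjoint (hf.toLp f) := by
  have hint : Integrable fun x => f x • K x := by
    have hK : AEStronglyMeasurable K (volume : Measure Ω) :=
      K.continuous.stronglyMeasurable.aestronglyMeasurable
    exact (hf.integrable one_le_two).smul_bdd _ hK (ae_of_all _ fun x => K.norm_coe_le_norm x)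
  refine ext_inner_left ℝ fun g => ?_
  rw [ContinuousLinearMap.adjoint_inner_right, ← integral_inner hint, L2.inner_def]
  refine integral_congr_ae ?_
  filter_upwards [coeFn_featureL2 K g, hf.coeFn_toLp] with x h1 h2
  rw [h1, h2, inner_smul_right, real_inner_comm]
  simp

end FeatureMap

/-! ### Continuity of the canonical feature map. -/

section MeanEmbedding

variable {Ω : Type*}
  {H : Type*} [NormedAddCommGroup H] [InnerProductSpace ℝ H] [CompleteSpace H] [RKHS ℝ H Ω ℝ]
  {k : Ω → Ω → ℝ}

/-- The inner products of the canonical features are the values of the kernel. -/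
theorem inner_kerFun_kerFun (hH : HasReproducingKernel H k) (x y : Ω) :
    inner ℝ (RKHS.kerFun H x (1 : ℝ)) (RKHS.kerFun H y (1 : ℝ)) = k x y := by
  rw [RKHS.inner_kerFun, hH x y]
  simp

/-- The canonical feature map of a continuous kernel is continuous. -/
theorem continuous_kerFun_one [TopologicalSpace Ω] (hH : HasReproducingKernel H k)
    (hk : Continuous (Function.uncurry k)) : Continuous fun x => RKHS.kerFun H x (1 : ℝ) := by
  rw [continuous_iff_continuousAt]
  intro x
  rw [ContinuousAt, tendsto_iff_norm_sub_tendsto_zero]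
  have hn : ∀ y, ‖RKHS.kerFun H y (1 : ℝ) - RKHS.kerFun H x (1 : ℝ)‖ =
      √(k y y - 2 * k y x + k x x) := by
    intro y
    rw [← Real.sqrt_sq (norm_nonneg _), norm_sub_sq_real, ← real_inner_self_eq_norm_sq,
      ← real_inner_self_eq_norm_sq, inner_kerFun_kerFun hH, inner_kerFun_kerFun hH,
      inner_kerFun_kerFun hH]
  simp_rw [hn]
  have hc : Continuous fun y => √(k y y - 2 * k y x + k x x) := by
    have h1 : Continuous fun y => k y y := hk.comp (continuous_id.prodMk continuous_id)
    have h2 : Continuous fun y => k y x := hk.comp (continuous_id.prodMk continuous_const)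
    fun_prop
  have := hc.tendsto x
  rwa [show k x x - 2 * k x x + k x x = 0 by ring, Real.sqrt_zero] at this

end MeanEmbedding

/-! ### Eigenvalues, coefficients and the regularity factor. -/

section Mercer

variable {Ω : Type*} [MeasureSpace Ω] {k : Ω → Ω → ℝ} {l : ℕ → ℝ} {φ : ℕ → Ω → ℝ}

/-- Under the Mercer condition the eigenvalues are positive. -/
theorem IsMercerSystem.eigenvalue_pos (hlφ : IsMercerSystem k l φ) (hMercer : MercerCondition k)
    (i : ℕ) : 0 < l i := by
  have h1 : ∫ x, φ i x * φ i x = 1 := by simpa using hlφ.orthonormal i i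
  have h0 : ¬ φ i =ᵐ[volume] 0 := by
    intro h
    have : ∫ x, φ i x * φ i x = 0 := integral_eq_zero_of_ae (by
      filter_upwards [h] with x hx
      simp [hx])
    linarith
  have h2 := hMercer _ (hlφ.eigen i).1 h0
  have h3 : ∫ x, ∫ y, k x y * φ i x * φ i y = ∫ x, l i * (φ i x * φ i x) := by
    refine integral_congr_ae ?_
    filter_upwards [(hlφ.eigen i).2] with x hx
    rw [integralOp] at hx
    calc ∫ y, k x y * φ i x * φ i y = ∫ y, φ i x * (k x y * φ i y) := by
          congr with y; ring
      _ = φ i x * ∫ y, k x y * φ i y := integral_const_mul _ _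
      _ = l i * (φ i x * φ i x) := by rw [hx]; ring
  rwa [h3, integral_const_mul, h1, mul_one] at h2

theorem mercerCoeff_eq_inner (hφ : ∀ i, MemLp (φ i) 2) {h : Ω → ℝ} (hh : MemLp h 2) (i : ℕ) :
    mercerCoeff φ h i = inner ℝ ((hφ i).toLp (φ i)) (hh.toLp h) := by
  rw [mercerCoeff, L2.inner_def]
  refine integral_congr_ae ?_
  filter_upwards [(hφ i).coeFn_toLp, hh.coeFn_toLp] with x h1 h2
  rw [h1, h2]
  simp

/-- A bound on the mode factor controls the sum of all squared coefficients by the first ones. -/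
theorem tsum_mercerCoeff_sq_le {h : Ω → ℝ} {N : ℕ} {cs : ℝ} (hcs : 0 < cs)
    (hsum : Summable fun i => mercerCoeff φ h i ^ 2)
    (hc : modeFactor φ h N ≤ ENNReal.ofReal cs) :
    ∑' i, mercerCoeff φ h i ^ 2 ≤ cs * ∑ i ∈ Finset.range (N + 1), mercerCoeff φ h i ^ 2 := by
  have hsum' : Summable fun i => mercerCoeff φ h (N + 1 + i) ^ 2 := by
    simpa [add_comm] using (summable_nat_add_iff (N + 1)).2 hsum
  have htot : ∑' i, mercerCoeff φ h i ^ 2 = ∑ i ∈ Finset.range (N + 1), mercerCoeff φ h i ^ 2 +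
      ∑' i, mercerCoeff φ h (N + 1 + i) ^ 2 := by
    rw [← hsum.sum_add_tsum_nat_add (N + 1)]
    simp [add_comm]
  rw [modeFactor, ← ENNReal.ofReal_tsum_of_nonneg (fun _ => sq_nonneg _) hsum',
    ← ENNReal.ofReal_sum_of_nonneg (fun _ _ => sq_nonneg _)] at hc
  rw [htot]
  set A := ∑ i ∈ Finset.range (N + 1), mercerCoeff φ h i ^ 2
  set B := ∑' i, mercerCoeff φ h (N + 1 + i) ^ 2
  have hA : 0 ≤ A := Finset.sum_nonneg fun _ _ => sq_nonneg _
  have hB : 0 ≤ B := tsum_nonneg fun _ => sq_nonneg _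
  -- If the leading coefficients vanish, a nonzero tail makes the factor infinite, contradicting the
  -- bound; a zero tail leaves `0 ≤ 0`.
  rcases hA.eq_or_lt with hA0 | hA0
  · rcases hB.eq_or_lt with hB0 | hB0
    · simp [← hA0, ← hB0]
    · rw [← hA0, ENNReal.ofReal_zero, ENNReal.div_zero (by simpa using hB0), add_top,
        top_le_iff] at hc
      exact absurd hc ENNReal.ofReal_ne_top
  · rw [← ENNReal.ofReal_div_of_pos hA0, ← ENNReal.ofReal_one,
      ← ENNReal.ofReal_add zero_le_one (by positivity), ENNReal.ofReal_le_ofReal_iff hcs.le] at hc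
    calc A + B = (1 + B / A) * A := by field_simp
      _ ≤ cs * A := mul_le_mul_of_nonneg_right hc hA

end Mercer

/-! ### Comparison of the `L²` norm with the embedded norm. -/

section Distance

variable {Ω : Type*} [TopologicalSpace Ω] [CompactSpace Ω] [SecondCountableTopology Ω]
  [MeasureSpace Ω] [BorelSpace Ω] [IsFiniteMeasure (volume : Measure Ω)]
  {H : Type*} [NormedAddCommGroup H] [InnerProductSpace ℝ H] [CompleteSpace H] [RKHS ℝ H Ω ℝ]
  {k : Ω → Ω → ℝ} {l : ℕ → ℝ} {φ : ℕ → Ω → ℝ}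

/-- The `L²` norm of a function with a bounded mode factor is controlled by the norm of its kernel
mean embedding. -/
theorem norm_toLp_le_norm_kernelMean (hk : Continuous (Function.uncurry k))
    (hH : HasReproducingKernel H k) (hMercer : MercerCondition k) (hlφ : IsMercerSystem k l φ)
    {N : ℕ} {cs : ℝ} (hcs : 0 < cs) {h : Ω → ℝ} (hh : MemLp h 2)
    (hc : modeFactor φ h N ≤ ENNReal.ofReal cs) :
    ‖hh.toLp h‖ ≤ √(cs / l N) * ‖kernelMean H h‖ := by
  let K : C(Ω, H) := ⟨fun x => RKHS.kerFun H x (1 : ℝ), continuous_kerFun_one hH hk⟩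
  have hKk : (fun x y => inner ℝ (K x) (K y)) = k := by
    ext x y
    exact inner_kerFun_kerFun hH x y
  have hmean : kernelMean H h = (featureL2 K).adjoint (hh.toLp h) :=
    integral_smul_eq_featureL2_adjoint K hh
  have hφ : ∀ i, MemLp (φ i) 2 := fun i => (hlφ.eigen i).1
  let v : ℕ → Lp ℝ 2 (volume : Measure Ω) := fun i => (hφ i).toLp (φ i)
  have hv : Orthonormal ℝ v := by
    rw [orthonormal_iff_ite]
    intro i j
    rw [← mercerCoeff_eq_inner hφ (hφ j) i, mercerCoeff, hlφ.orthonormal j i]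
    simp [eq_comm]
  have heig : ∀ i, featureL2 K ((featureL2 K).adjoint (v i)) = l i • v i := by
    intro i
    refine Lp.ext ?_
    filter_upwards [coeFn_featureL2_adjoint K (hφ i), (hlφ.eigen i).2,
      Lp.coeFn_smul (l i) (v i), (hφ i).coeFn_toLp] with x h1 h2 h3 h4
    rw [h1, hKk, h2, h3, Pi.smul_apply, h4, smul_eq_mul]
  let T : Lp ℝ 2 (volume : Measure Ω) →L[ℝ] Lp ℝ 2 (volume : Measure Ω) :=
    (featureL2 K).comp (featureL2 K).adjoint
  have hT : IsCompactOperator T :=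
    (isCompactOperator_featureL2 K).comp_clm (featureL2 K).adjoint
  have hT' : (T : Lp ℝ 2 (volume : Measure Ω) →ₗ[ℝ] _).IsSymmetric := by
    intro x y
    change inner ℝ (featureL2 K ((featureL2 K).adjoint x)) y =
      inner ℝ x (featureL2 K ((featureL2 K).adjoint y))
    exact (ContinuousLinearMap.adjoint_inner_right _ _ _).symm.trans
      (ContinuousLinearMap.adjoint_inner_left _ _ _)
  -- Exhaustiveness of the eigensystem becomes completeness of the family `v`, so that Parseval's
  -- identity holds for `h`.
  have hspan : (Submodule.span ℝ (Set.range v))ᗮ = ⊥ := by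
    refine orthogonal_span_eigenvectors_eq_bot hT hT' heig fun m x hx hort => ?_
    have hxL : MemLp x 2 := Lp.memLp x
    have hxx : hxL.toLp x = x := Lp.toLp_coeFn x hxL
    have hx0 : (x : Ω → ℝ) =ᵐ[volume] 0 := by
      refine hlφ.exhaustive m x ⟨hxL, ?_⟩ fun i => ?_
      · have h1 := coeFn_featureL2_adjoint K hxL
        rw [hKk, hxx] at h1
        have h2 : featureL2 K ((featureL2 K).adjoint x) = m • x := hx
        rw [h2] at h1
        filter_upwards [h1, Lp.coeFn_smul m x] with y h3 h4
        rw [← h3, h4, Pi.smul_apply, smul_eq_mul]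
      · have h1 := mercerCoeff_eq_inner hφ hxL i
        rw [hxx] at h1
        exact h1.trans (hort i)
    exact Lp.eq_zero_iff_ae_eq_zero.2 hx0
  let b := HilbertBasis.mkOfOrthogonalEqBot hv hspan
  have hpars : HasSum (fun i => mercerCoeff φ h i ^ 2) (‖hh.toLp h‖ ^ 2) := by
    have h1 := b.hasSum_inner_mul_inner (hh.toLp h) (hh.toLp h)
    rw [real_inner_self_eq_norm_sq] at h1
    have h2 : (fun i => inner ℝ (hh.toLp h) (b i) * inner ℝ (b i) (hh.toLp h)) =
        fun i => mercerCoeff φ h i ^ 2 := by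
      ext i
      rw [HilbertBasis.coe_mkOfOrthogonalEqBot, real_inner_comm, mercerCoeff_eq_inner hφ hh, sq]
    rwa [h2] at h1
  have hl : 0 < l N := hlφ.eigenvalue_pos hMercer N
  have h1 := tsum_mercerCoeff_sq_le hcs hpars.summable hc
  rw [hpars.tsum_eq] at h1
  have h2 := mul_sum_inner_sq_le_norm_adjoint_sq (featureL2 K) hv hlφ.antitone heig N (hh.toLp h)
  rw [← hmean] at h2
  simp_rw [v, ← mercerCoeff_eq_inner hφ hh] at h2
  refine (sq_le_sq₀ (norm_nonneg _) (by positivity)).1 ?_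
  rw [mul_pow, Real.sq_sqrt (by positivity), div_mul_eq_mul_div, le_div_iff₀ hl]
  calc ‖hh.toLp h‖ ^ 2 * l N
      ≤ (cs * ∑ i ∈ Finset.range (N + 1), mercerCoeff φ h i ^ 2) * l N :=
        mul_le_mul_of_nonneg_right h1 hl.le
    _ = cs * (l N * ∑ i ∈ Finset.range (N + 1), mercerCoeff φ h i ^ 2) := by ring
    _ ≤ cs * ‖kernelMean H h‖ ^ 2 := mul_le_mul_of_nonneg_left h2 hcs.le

/-- The kernel mean embedding of a difference. -/
theorem kernelMean_sub (hk : Continuous (Function.uncurry k)) (hH : HasReproducingKernel H k)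
    {f g : Ω → ℝ} (hf : MemLp f 2) (hg : MemLp g 2) :
    kernelMean H (f - g) = kernelMean H f - kernelMean H g := by
  let K : C(Ω, H) := ⟨fun x => RKHS.kerFun H x (1 : ℝ), continuous_kerFun_one hH hk⟩
  have hm : ∀ {h : Ω → ℝ} (hh : MemLp h 2),
      kernelMean H h = (featureL2 K).adjoint (hh.toLp h) := fun hh =>
    integral_smul_eq_featureL2_adjoint K hh
  rw [hm (hf.sub hg), hm hf, hm hg, MemLp.toLp_sub, map_sub]

end Distance

end KernelTM

/-! ### Assembly of the estimates. -/

theorem mainTheorem2 {n : ℕ} (X : Set (EuclideanSpace ℝ (Fin n))) (hX : IsCompact X)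
    -- time-τ transition densities and invariant density
    (p : X → X → ℝ) (ρ : X → ℝ)
    (hp : KernelTM.IsTransitionDensity p) (hρ : KernelTM.IsInvariantDensity p ρ)
    -- the transition manifold, or any other set of square integrable transition densities
    (M : Set (X → ℝ)) (hM : M ⊆ KernelTM.fuzzyTransitionManifold p)
    (hML2 : ∀ f ∈ M, MeasureTheory.MemLp f 2 MeasureTheory.volume)
    -- kernel, its reproducing kernel Hilbert space, and its Mercer eigenpairs
    (k : X → X → ℝ) (hk : Continuous (Function.uncurry k))
    (H : Type*) [NormedAddCommGroup H] [InnerProductSpace ℝ H] [CompleteSpace H] [RKHS ℝ H X ℝ]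
    (hH : KernelTM.HasReproducingKernel H k)
    (hMercer : KernelTM.MercerCondition k)
    (l : ℕ → ℝ) (φ : ℕ → X → ℝ) (hlφ : KernelTM.IsMercerSystem k l φ)
    -- regularity bound for the index imax
    (imax : ℕ) (cs : ℝ) (hcs : 0 < cs) (hreg : KernelTM.RegularityBound φ M imax cs)
    -- metastable decomposition
    {d : ℕ} (c pA : Fin d → X → ℝ) (δ : X → X → ℝ) (δs : ℝ)
    (hdec : KernelTM.IsMetastableDecomposition p c pA δ δs)
    (hb : ∀ i, 0 < KernelTM.attractedMass ρ (c i))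
    -- lower bound on the distances that are considered
    (C : ℝ) (hC : 0 < C) :
    ∀ f ∈ M, ∀ g ∈ M, ENNReal.ofReal C ≤ KernelTM.weightedL2Norm ρ (f - g) →
      KernelTM.weightedL2Norm ρ (f - g) <
        ENNReal.ofReal
          (√((MeasureTheory.volume X).toReal) /
              (C * (1 - δs) * ⨅ i, KernelTM.attractedMass ρ (c i)) *
            √(cs / l imax) *
            ‖KernelTM.kernelMean H f - KernelTM.kernelMean H g‖) := by
  intro f hf g hg hCle
  have : CompactSpace X := isCompact_iff_compactSpace.1 hX
  have hvol : (volume : Measure X) Set.univ = volume X := by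
    rw [Measure.Subtype.volume_univ hX.measurableSet.nullMeasurableSet]
  have : IsFiniteMeasure (volume : Measure X) := ⟨by rw [hvol]; exact hX.measure_lt_top⟩
  have hfL := hML2 f hf
  have hgL := hML2 g hg
  have hhL : MemLp (f - g) 2 := hfL.sub hgL
  obtain ⟨x₁, rfl⟩ := hM hf
  obtain ⟨x₂, rfl⟩ := hM hg
  set h := p x₁ - p x₂ with hh
  set β := ⨅ i, KernelTM.attractedMass ρ (c i)
  have hβ : 0 < β := KernelTM.iInf_attractedMass_pos hp x₁ hdec hb
  have hδ : 0 < 1 - δs := by linarith [hdec.deltaStar_lt_one]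
  have hκ : 0 < (1 - δs) * β := mul_pos hδ hβ
  -- Positivity of `C` excludes `h = 0`, where the strict inequality would fail.
  have hne : ¬ h =ᵐ[volume] 0 := by
    intro h0
    have h1 : KernelTM.weightedL2Norm ρ h = 0 :=
      (eLpNorm_congr_ae (withDensity_absolutelyContinuous _ _ |>.ae_eq h0)).trans eLpNorm_zero
    rw [h1, nonpos_iff_eq_zero, ENNReal.ofReal_eq_zero] at hCle
    linarith
  have hne' : ¬ p x₁ =ᵐ[volume] p x₂ := fun h0 => hne (by
    filter_upwards [h0] with y hy
    simp [hh, hy])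
  have hlt : ∀ᵐ y, (1 - δs) * β * |h y| < ρ y := by
    filter_upwards [KernelTM.ae_iInf_attractedMass_mul_lt hp hρ hdec hb] with y hy
    -- Both densities are nonnegative, so the maximum suffices; the triangle inequality would cost a
    -- factor `2`.
    have habs : |h y| ≤ max (p x₁ y) (p x₂ y) := by
      rw [hh, Pi.sub_apply, abs_le]
      constructor
      · linarith [le_max_right (p x₁ y) (p x₂ y), hp.nonneg x₁ y]
      · linarith [le_max_left (p x₁ y) (p x₂ y), hp.nonneg x₂ y]
    refine (mul_le_mul_of_nonneg_left habs hκ.le).trans_lt ?_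
    rcases max_choice (p x₁ y) (p x₂ y) with hm | hm <;> rw [hm]
    exacts [hy x₁, hy x₂]
  have hmeas : ∀ x, Measurable (p x) := fun x => hp.measurable.of_uncurry_left
  have hW := KernelTM.weightedL2Norm_sq_lt hκ hρ.measurable ((hmeas x₁).sub (hmeas x₂))
    (hhL.integrable one_le_two) hlt hne
  have hL1 := KernelTM.integral_abs_le_sqrt_mul_norm hhL
  rw [hvol] at hL1
  have hL2 := KernelTM.norm_toLp_le_norm_kernelMean hk hH hMercer hlφ hcs hhL
    (hreg _ hf _ hg hne')
  rw [KernelTM.kernelMean_sub hk hH hfL hgL] at hL2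
  have hWtop : KernelTM.weightedL2Norm ρ h ≠ ∞ := fun ht => by
    rw [ht] at hW
    simp at hW
  obtain ⟨w, hw0, hw⟩ : ∃ w : ℝ, 0 ≤ w ∧ KernelTM.weightedL2Norm ρ h = ENNReal.ofReal w :=
    ⟨_, ENNReal.toReal_nonneg, (ENNReal.ofReal_toReal hWtop).symm⟩
  rw [hw] at hW hCle ⊢
  rw [ENNReal.ofReal_le_ofReal_iff hw0] at hCle
  rw [← ENNReal.ofReal_pow hw0] at hW
  have hW' := (ENNReal.ofReal_lt_ofReal_iff_of_nonneg (sq_nonneg w)).1 hW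
  rw [ENNReal.ofReal_lt_ofReal_iff_of_nonneg hw0]
  set m := ‖KernelTM.kernelMean H (p x₁) - KernelTM.kernelMean H (p x₂)‖
  set V := √((volume X).toReal)
  have hV : 0 ≤ V := Real.sqrt_nonneg _
  -- Since `C ≤ w`, one has `w ≤ w² / C`; the quadratic estimate then gives the linear one.
  calc w = C * w / C := by field_simp
    _ ≤ w ^ 2 / C := by
        rw [sq]
        exact div_le_div_of_nonneg_right (mul_le_mul_of_nonneg_right hCle hw0) hC.le
    _ < ((1 - δs) * β)⁻¹ * (∫ y, |h y|) / C := div_lt_div_of_pos_right hW' hC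
    _ ≤ ((1 - δs) * β)⁻¹ * (V * (√(cs / l imax) * m)) / C := by
        refine div_le_div_of_nonneg_right (mul_le_mul_of_nonneg_left ?_ (by positivity)) hC.le
        exact hL1.trans (mul_le_mul_of_nonneg_left hL2 hV)
    _ = V / (C * (1 - δs) * β) * √(cs / l imax) * m := by
        field_simp
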